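/- Let $m \ge 2$ and $k \ge 2$ be integers. Let $\mathfrak f_m$ be the free real Lie algebra on $m$ generators, with lower central series $C^0(\mathfrak f_m)=\mathfrak f_m$, $C^{r+1}(\mathfrak f_m)=[\mathfrak f_m, C^{r}(\mathfrak f_m)]$, and let $\mathfrak n_{m,k}=\mathfrak f_m/C^{k}(\mathfrak f_m)$ be the free $k$-step nilpotent Lie algebra on $m$ generators (a finite-dimensional real Lie algebra). A symplectic structure on a finite-dimensional real Lie algebra $\mathfrak g$ is a non-degenerate alternating bilinear form $\omega:\mathfrak g\times\mathfrak g\to\mathbb R$ which is closed, i.e. $\omega([x,y],z)+\omega([y,z],x)+\omega([z,x],y)=0$ for all $x,y,z\in\mathfrak g$. Then: 1. If $\dim \mathfrak n_{m,k}$ is even, then $\mathfrak n_{m,k}$ admits a symplectic structure if and only if $(m,k)=(3,2)$. 2. If $\dim \mathfrak n_{m,k}$ is odd, then the one-dimensional central extension $\mathbb R\oplus\mathfrak n_{m,k}$ (the direct sum of Lie algebras with the abelian Lie algebra $\mathbb R$) admits a symplectic structure if and only if $(m,k)=(2,2)$. -/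

import Mathlib

/- The commutator bracket of an associative ring. It is used only to regard the commutative ring
`ℝ` as the one-dimensional abelian Lie algebra. -/
attribute [local instance 100] LieRing.ofAssociativeRing

/-- The free `k`-step nilpotent real Lie algebra on `m` generators: the quotient of the free Lie
algebra `f` on `m` generators by the term `C^k(f)` of its lower central series, where `C^0(f) = f`
and `C^(r+1)(f) = [f, C^r(f)]`. Thus exactly the brackets of more than `k` elements vanish. -/
abbrev FreeNilpotentLieAlgebra (m k : ℕ) : Type :=
  FreeLieAlgebra ℝ (Fin m) ⧸
    (LieModule.lowerCentralSeries ℝ (FreeLieAlgebra ℝ (Fin m)) (FreeLieAlgebra ℝ (Fin m)) k :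
      LieIdeal ℝ (FreeLieAlgebra ℝ (Fin m)))

/-- A bilinear form `ω` on a real Lie algebra is a symplectic structure if it is a `2`-form
(alternating), closed for the Chevalley–Eilenberg differential
`(dω)(x, y, z) = -(ω([x,y],z) + ω([y,z],x) + ω([z,x],y))`, and non-degenerate. -/
structure IsSymplecticStructure {L : Type*} [LieRing L] [LieAlgebra ℝ L]
    (ω : LinearMap.BilinForm ℝ L) : Prop where
  alternating : ω.IsAlt
  closed : ∀ x y z : L, ω ⁅x, y⁆ z + ω ⁅y, z⁆ x + ω ⁅z, x⁆ y = 0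
  nondegenerate : ω.Nondegenerate

/-- A real Lie algebra is symplectic if it admits a symplectic structure. -/
def IsSymplecticLieAlgebra (L : Type*) [LieRing L] [LieAlgebra ℝ L] : Prop :=
  ∃ ω : LinearMap.BilinForm ℝ L, IsSymplecticStructure ω

/-! Closedness makes the centre of a symplectic Lie algebra orthogonal to all brackets. In
$\mathfrak n_{m,k}$ the term $C^{k-1}$ is central, and the algebra is spanned by its $m$ generators
and the brackets. So an element $z$ of $C^{k-1}$ is determined by the $m$ numbers $\omega(x_i, z)$,
and $\dim C^{k-1} \le m$ (`card_le_of_isSymplectic`). In $\mathbb R \oplus \mathfrak n_{m,k}$ the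
extra central direction joins $C^{k-1}$ in this count, which gives $\dim C^{k-1} + 1 \le m$
(`card_lt_of_isSymplectic_prod`).

Usually $C^{k-1}$ is larger than that. The metabelian representation `toAffine` shows it: in its
ideal $\mathbb R[y][T]$ the generator $x_0$ acts as $T$ and $x_1$ as $Ty$, while $[x_0, x_j]$ maps
to $Ty^{3j}$ and, for $j \ge 2$, $[x_1, x_j]$ maps to $Ty^{3j+1}$. Iterated brackets thus reach
$T^{k-1}y^n$ for many $n$, and distinct $n$ give independent elements. More than $m$ exponents occur
unless $(m,k)$ is $(2,2)$, $(2,3)$ or $(3,2)$, and at least $m$ occur unless it is $(2,2)$.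

The algebras for $(2,2)$ and $(2,3)$ have dimensions 3 and 5, so parity removes them from the even
case. Explicit forms in coordinates settle $(3,2)$ and $\mathbb R \oplus \mathfrak n_{2,2}$. -/

noncomputable section

open LieModule Polynomial

/-! ### Free Lie algebras and the lower central series -/

namespace FreeLieAlgebra

variable {X L : Type*} [LieRing L] [LieAlgebra ℝ L]

/-- A subspace of a free Lie algebra which contains the generators and all brackets is everything. -/
theorem submodule_eq_top (K : Submodule ℝ (FreeLieAlgebra ℝ X))
    (hof : ∀ i, of ℝ i ∈ K) (hlie : ∀ x y : FreeLieAlgebra ℝ X, ⁅x, y⁆ ∈ K) : K = ⊤ := by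
  let S : LieSubalgebra ℝ (FreeLieAlgebra ℝ X) := { K with lie_mem' := fun _ _ => hlie _ _ }
  -- Lifting the generators into `S` and including back is the identity, by the universal property;
  -- hence every element lies in `S`.
  have h : S.incl.comp (lift ℝ fun i => (⟨of ℝ i, hof i⟩ : S)) = LieHom.id := by
    ext i
    simp
  refine (Submodule.eq_top_iff').2 fun x => ?_
  have hx := LieHom.congr_fun h x
  simp only [LieHom.comp_apply, LieHom.id_apply] at hx
  rw [← hx]
  exact (lift ℝ (fun i => (⟨of ℝ i, hof i⟩ : S)) x).2

end FreeLieAlgebra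

/-- The lower central series is the smallest filtration `F` with `F 0 = ⊤` and
`[L, F r] ⊆ F (r + 1)`. -/
theorem lowerCentralSeries_le_of_filtration {L : Type*} [LieRing L] [LieAlgebra ℝ L]
    (F : ℕ → Submodule ℝ L) (h0 : F 0 = ⊤)
    (hF : ∀ r, ∀ x : L, ∀ y ∈ F r, ⁅x, y⁆ ∈ F (r + 1)) (r : ℕ) :
    (lowerCentralSeries ℝ L L r).toSubmodule ≤ F r := by
  induction r with
  | zero => simp [h0]
  | succ r ih =>
    rw [lowerCentralSeries_succ, LieSubmodule.lieIdeal_oper_eq_linear_span', Submodule.span_le]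
    rintro _ ⟨x, -, y, hy, rfl⟩
    exact hF r x y (ih hy)

theorem lie_mem_lowerCentralSeries {L : Type*} [LieRing L] [LieAlgebra ℝ L] {r : ℕ} (x : L) {y : L}
    (hy : y ∈ lowerCentralSeries ℝ L L r) : ⁅x, y⁆ ∈ lowerCentralSeries ℝ L L (r + 1) := by
  rw [lowerCentralSeries_succ]
  exact LieSubmodule.lie_mem_lie (LieSubmodule.mem_top x) hy

/-! ### Free nilpotent quotients and their universal property -/

namespace FreeNilpotentLieAlgebra

variable {m k : ℕ}

/-- The projection from the free Lie algebra. -/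
def proj (m k : ℕ) : FreeLieAlgebra ℝ (Fin m) →ₗ⁅ℝ⁆ FreeNilpotentLieAlgebra m k where
  toLinearMap := (LieSubmodule.toSubmodule (lowerCentralSeries ℝ (FreeLieAlgebra ℝ (Fin m))
    (FreeLieAlgebra ℝ (Fin m)) k)).mkQ
  map_lie' := rfl

theorem proj_surjective : Function.Surjective (proj m k) := Submodule.mkQ_surjective _

theorem proj_eq_zero {x : FreeLieAlgebra ℝ (Fin m)} : proj m k x = 0 ↔
    x ∈ lowerCentralSeries ℝ (FreeLieAlgebra ℝ (Fin m)) (FreeLieAlgebra ℝ (Fin m)) k :=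
  Submodule.Quotient.mk_eq_zero _

/-- A linear map which vanishes on a term of the lower central series descends. -/
def liftLinear {V : Type*} [AddCommGroup V] [Module ℝ V] (f : FreeLieAlgebra ℝ (Fin m) →ₗ[ℝ] V)
    (hf : ∀ x ∈ lowerCentralSeries ℝ (FreeLieAlgebra ℝ (Fin m)) (FreeLieAlgebra ℝ (Fin m)) k,
      f x = 0) : FreeNilpotentLieAlgebra m k →ₗ[ℝ] V :=
  (LieSubmodule.toSubmodule (lowerCentralSeries ℝ (FreeLieAlgebra ℝ (Fin m))
    (FreeLieAlgebra ℝ (Fin m)) k)).liftQ f hf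

/-- A Lie algebra homomorphism which vanishes on a term of the lower central series descends. -/
def liftHom {L : Type*} [LieRing L] [LieAlgebra ℝ L] (f : FreeLieAlgebra ℝ (Fin m) →ₗ⁅ℝ⁆ L)
    (hf : ∀ x ∈ lowerCentralSeries ℝ (FreeLieAlgebra ℝ (Fin m)) (FreeLieAlgebra ℝ (Fin m)) k,
      f x = 0) : FreeNilpotentLieAlgebra m k →ₗ⁅ℝ⁆ L where
  toLinearMap := liftLinear (f : FreeLieAlgebra ℝ (Fin m) →ₗ[ℝ] L) hf
  map_lie' := by
    intro x y
    obtain ⟨x, rfl⟩ := proj_surjective x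
    obtain ⟨y, rfl⟩ := proj_surjective y
    exact f.map_lie x y

@[simp]
theorem liftHom_proj {L : Type*} [LieRing L] [LieAlgebra ℝ L] (f : FreeLieAlgebra ℝ (Fin m) →ₗ⁅ℝ⁆ L)
    (hf : ∀ x ∈ lowerCentralSeries ℝ (FreeLieAlgebra ℝ (Fin m)) (FreeLieAlgebra ℝ (Fin m)) k,
      f x = 0) (x : FreeLieAlgebra ℝ (Fin m)) : liftHom f hf (proj m k x) = f x :=
  rfl

/-- The generators. -/
def gen (m k : ℕ) (i : Fin m) : FreeNilpotentLieAlgebra m k := proj m k (FreeLieAlgebra.of ℝ i)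

theorem submodule_eq_top (K : Submodule ℝ (FreeNilpotentLieAlgebra m k))
    (hgen : ∀ i, gen m k i ∈ K) (hlie : ∀ x y : FreeNilpotentLieAlgebra m k, ⁅x, y⁆ ∈ K) :
    K = ⊤ := by
  have h := FreeLieAlgebra.submodule_eq_top
    (K.comap (proj m k : FreeLieAlgebra ℝ (Fin m) →ₗ[ℝ] FreeNilpotentLieAlgebra m k)) hgen
    fun x y => by simpa using hlie _ _
  refine (Submodule.eq_top_iff').2 fun x => ?_
  obtain ⟨x, rfl⟩ := proj_surjective x
  exact (Submodule.eq_top_iff'.1 h x :)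

/-- Let `L` be a Lie algebra with a filtration that vanishes in degree `k`. A homomorphism `g` from
`L` to the free nilpotent Lie algebra sending `y i` to the generators is bijective if it is a right
inverse of every homomorphism sending the generators to `y i`. -/
theorem exists_bijective_of_section {L : Type*} [LieRing L] [LieAlgebra ℝ L] (y : Fin m → L)
    (F : ℕ → Submodule ℝ L) (h0 : F 0 = ⊤)
    (hF : ∀ r, ∀ x : L, ∀ y ∈ F r, ⁅x, y⁆ ∈ F (r + 1)) (hk : F k = ⊥)
    (g : L →ₗ[ℝ] FreeNilpotentLieAlgebra m k) (hg : ∀ x y, g ⁅x, y⁆ = ⁅g x, g y⁆)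
    (hgy : ∀ i, g (y i) = gen m k i)
    (hy : ∀ ψ : FreeNilpotentLieAlgebra m k →ₗ⁅ℝ⁆ L, (∀ i, ψ (gen m k i) = y i) →
      ∀ x, ψ (g x) = x) :
    ∃ ψ : FreeNilpotentLieAlgebra m k →ₗ⁅ℝ⁆ L, Function.Bijective ψ := by
  let φ := FreeLieAlgebra.lift ℝ y
  have hφ : ∀ x ∈ lowerCentralSeries ℝ (FreeLieAlgebra ℝ (Fin m)) (FreeLieAlgebra ℝ (Fin m)) k,
      φ x = 0 := by
    intro x hx
    have := lowerCentralSeries_le_of_filtration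
      (fun r => (F r).comap (φ : FreeLieAlgebra ℝ (Fin m) →ₗ[ℝ] L)) (by simp [h0])
      (fun r x y hy => by simpa using hF r _ _ hy) k hx
    simpa [hk] using this
  let g' : L →ₗ⁅ℝ⁆ FreeNilpotentLieAlgebra m k := { g with map_lie' := hg _ _ }
  have hg' : g'.comp φ = proj m k := by
    ext i
    change g (FreeLieAlgebra.lift ℝ y (FreeLieAlgebra.of ℝ i)) = _
    rw [FreeLieAlgebra.lift_of_apply, hgy]
    rfl
  -- That `g` is a left inverse follows from `hg'`, an equality of maps checked on generators; that
  -- it is a right inverse is the hypothesis `hy`.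
  refine ⟨liftHom φ hφ, Function.bijective_iff_has_inverse.2 ⟨g, fun x => ?_, hy _ fun i => ?_⟩⟩
  · obtain ⟨x, rfl⟩ := proj_surjective x
    rw [liftHom_proj]
    exact LieHom.congr_fun hg' x
  · exact FreeLieAlgebra.lift_of_apply _ _

end FreeNilpotentLieAlgebra

/-! ### Symplectic forms and the centre -/

namespace IsSymplecticStructure

variable {L L' : Type*} [LieRing L] [LieAlgebra ℝ L] [LieRing L'] [LieAlgebra ℝ L']
  {ω : LinearMap.BilinForm ℝ L}

theorem of_separatingLeft (halt : ω.IsAlt)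
    (hcl : ∀ x y z : L, ω ⁅x, y⁆ z + ω ⁅y, z⁆ x + ω ⁅z, x⁆ y = 0)
    (h : ∀ x, (∀ y, ω x y = 0) → x = 0) : IsSymplecticStructure ω :=
  ⟨halt, hcl, (LinearMap.IsRefl.nondegenerate_iff_separatingLeft halt.isRefl).2 h⟩

theorem apply_comm_eq_zero (h : IsSymplecticStructure ω) {x y : L} (hxy : ω x y = 0) :
    ω y x = 0 :=
  h.alternating.isRefl x y hxy

/-- The center is orthogonal to all brackets. -/
theorem lie_left_eq_zero (h : IsSymplecticStructure ω) {z : L} (hz : ∀ x : L, ⁅x, z⁆ = 0) (x y : L) :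
    ω ⁅x, y⁆ z = 0 := by
  have := h.closed x y z
  rwa [hz y, ← lie_skew z x, hz x, neg_zero, map_zero, LinearMap.zero_apply, LinearMap.zero_apply,
    add_zero, add_zero] at this

theorem eq_zero (h : IsSymplecticStructure ω) {z : L} (hz : ∀ x, ω x z = 0) : z = 0 :=
  h.nondegenerate.2 z hz

/-- Linearly independent vectors in a subspace on which `m` functionals `ω (g i)` detect zero
are at most `m`. -/
theorem card_le {ι : Type*} [Fintype ι] {m : ℕ} (w : ι → L) (g : Fin m → L)
    (hw : LinearIndependent ℝ w)
    (h : ∀ z ∈ Submodule.span ℝ (Set.range w), (∀ i, ω (g i) z = 0) → z = 0) :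
    Fintype.card ι ≤ m := by
  have hli := hw.map (f := LinearMap.pi fun i => ω (g i)) (by
    rw [Submodule.disjoint_def]
    intro z hz hz'
    exact h z hz fun i => congrFun (LinearMap.mem_ker.1 hz') i)
  simpa using hli.fintype_card_le_finrank

theorem comp (h : IsSymplecticStructure ω) (F : L' →ₗ⁅ℝ⁆ L) (hF : Function.Bijective F) :
    IsSymplecticStructure (ω.comp (F : L' →ₗ[ℝ] L) (F : L' →ₗ[ℝ] L)) := by
  refine of_separatingLeft (fun x => h.alternating _) (fun x y z => ?_) fun x hx => ?_
  · simpa using h.closed (F x) (F y) (F z)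
  · refine hF.1 ?_
    rw [map_zero]
    refine h.nondegenerate.1 _ fun y => ?_
    obtain ⟨y, rfl⟩ := hF.2 y
    exact hx y

end IsSymplecticStructure

theorem IsSymplecticLieAlgebra.of_bijective {L L' : Type*} [LieRing L] [LieAlgebra ℝ L] [LieRing L']
    [LieAlgebra ℝ L'] (h : IsSymplecticLieAlgebra L) (F : L' →ₗ⁅ℝ⁆ L) (hF : Function.Bijective F) :
    IsSymplecticLieAlgebra L' :=
  let ⟨_, hω⟩ := h
  ⟨_, hω.comp F hF⟩

/-! ### Upper bounds on the last term of the lower central series -/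

namespace FreeNilpotentLieAlgebra

variable {m k : ℕ}

theorem lie_proj_eq_zero {z : FreeLieAlgebra ℝ (Fin m)}
    (hz : z ∈ lowerCentralSeries ℝ (FreeLieAlgebra ℝ (Fin m)) (FreeLieAlgebra ℝ (Fin m)) k)
    (x : FreeNilpotentLieAlgebra m (k + 1)) : ⁅x, proj m (k + 1) z⁆ = 0 := by
  obtain ⟨x, rfl⟩ := proj_surjective x
  rw [← LieHom.map_lie, proj_eq_zero]
  exact lie_mem_lowerCentralSeries x hz

/-- The last term of the lower central series, a subspace of the center. -/
def last (m k : ℕ) : Submodule ℝ (FreeNilpotentLieAlgebra m (k + 1)) :=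
  (LieSubmodule.toSubmodule (lowerCentralSeries ℝ (FreeLieAlgebra ℝ (Fin m))
    (FreeLieAlgebra ℝ (Fin m)) k)).map (proj m (k + 1) : _ →ₗ[ℝ] _)

theorem lie_last {z : FreeNilpotentLieAlgebra m (k + 1)} (hz : z ∈ last m k)
    (x : FreeNilpotentLieAlgebra m (k + 1)) : ⁅x, z⁆ = 0 := by
  obtain ⟨z, hz, rfl⟩ := hz
  exact lie_proj_eq_zero hz x

/-- A central `z` is orthogonal to all brackets. If it is also orthogonal to the generators, it is
orthogonal to everything and vanishes by non-degeneracy. -/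
theorem card_le_of_isSymplectic (h : IsSymplecticLieAlgebra (FreeNilpotentLieAlgebra m (k + 1)))
    {ι : Type*} [Fintype ι] (w : ι → FreeNilpotentLieAlgebra m (k + 1))
    (hw : LinearIndependent ℝ w) (hlast : ∀ i, w i ∈ last m k) : Fintype.card ι ≤ m := by
  obtain ⟨ω, hω⟩ := h
  refine IsSymplecticStructure.card_le (ω := ω) w (gen m (k + 1)) hw fun z hz hgz => ?_
  have hz' : z ∈ last m k := Submodule.span_le.2 (Set.range_subset_iff.2 hlast) hz
  have := submodule_eq_top (LinearMap.ker (ω.flip z)) hgz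
    fun x y => hω.lie_left_eq_zero (lie_last hz') x y
  exact hω.eq_zero fun x => (Submodule.eq_top_iff'.1 this x :)

/-- The same count applies to the central subspace spanned by `e = (1, 0)` and the last term. The
generators do not span the direction `e` modulo brackets, so orthogonality to `e` needs its own
argument: the last term consists of sums of brackets, hence is orthogonal to the central vector `e`,
and `ω e e = 0`. -/
theorem card_lt_of_isSymplectic_prod
    (h : IsSymplecticLieAlgebra (ℝ × FreeNilpotentLieAlgebra m (k + 2)))
    {ι : Type*} [Fintype ι] (w : ι → FreeNilpotentLieAlgebra m (k + 2))
    (hw : LinearIndependent ℝ w) (hlast : ∀ i, w i ∈ last m (k + 1)) : Fintype.card ι + 1 ≤ m := by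
  obtain ⟨ω, hω⟩ := h
  let e : ℝ × FreeNilpotentLieAlgebra m (k + 2) := (1, 0)
  have hc : ∀ z : ℝ × FreeNilpotentLieAlgebra m (k + 2), z.2 ∈ last m (k + 1) →
      ∀ x : ℝ × FreeNilpotentLieAlgebra m (k + 2), ⁅x, z⁆ = 0 := fun z hz x =>
    Prod.ext (by simp [LieRing.of_associative_ring_bracket, mul_comm]) (lie_last hz x.2)
  let w' : ι → ℝ × FreeNilpotentLieAlgebra m (k + 2) :=
    LinearMap.inr ℝ ℝ (FreeNilpotentLieAlgebra m (k + 2)) ∘ w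
  have hspan : ∀ z ∈ Submodule.span ℝ (Set.range w'), z.1 = 0 := by
    intro z hz
    have : Submodule.span ℝ (Set.range w') ≤
        LinearMap.ker (LinearMap.fst ℝ ℝ (FreeNilpotentLieAlgebra m (k + 2))) := by
      rw [Submodule.span_le]
      rintro _ ⟨i, rfl⟩
      simp [w']
    exact this hz
  have hli : LinearIndependent ℝ (fun o : Option ι => o.casesOn' e w') := by
    refine LinearIndependent.option (hw.map' _ ?_) fun he' => ?_
    · exact LinearMap.ker_eq_bot.2 LinearMap.inr_injective
    · simpa [e] using hspan _ he'
  have hee : ω e e = 0 := hω.alternating e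
  -- The index `k + 1` is positive, so this term is spanned by brackets; this is why the step is `k
  -- + 2`.
  have helast : ∀ z ∈ last m (k + 1), ω (0, z) e = 0 := by
    let K := LinearMap.ker ((ω.flip e).comp ((LinearMap.inr ℝ ℝ _).comp
      (proj m (k + 2) : FreeLieAlgebra ℝ (Fin m) →ₗ[ℝ] FreeNilpotentLieAlgebra m (k + 2))))
    have hK : (lowerCentralSeries ℝ (FreeLieAlgebra ℝ (Fin m))
        (FreeLieAlgebra ℝ (Fin m)) (k + 1)).toSubmodule ≤ K := by
      rw [lowerCentralSeries_succ, LieSubmodule.lieIdeal_oper_eq_linear_span', Submodule.span_le]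
      rintro _ ⟨x, -, y, -, rfl⟩
      have := hω.lie_left_eq_zero (hc e (Submodule.zero_mem _)) (0, proj m (k + 2) x)
        (0, proj m (k + 2) y)
      simpa [K] using this
    rintro _ ⟨z, hz, rfl⟩
    exact hK hz
  have := IsSymplecticStructure.card_le (ω := ω) _ (fun i => ((0 : ℝ), gen m (k + 2) i)) hli
    fun z hz hgz => by
      have hz' : z.2 ∈ last m (k + 1) := by
        have : Submodule.span ℝ (Set.range fun o : Option ι => o.casesOn' e w') ≤
            (last m (k + 1)).comap (LinearMap.snd ℝ ℝ (FreeNilpotentLieAlgebra m (k + 2))) := by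
          rw [Submodule.span_le]
          rintro _ ⟨_ | i, rfl⟩
          · exact (last m (k + 1)).zero_mem
          · exact hlast i
        exact this hz
      have htop := submodule_eq_top (LinearMap.ker ((ω.flip z).comp
        (LinearMap.inr ℝ ℝ (FreeNilpotentLieAlgebra m (k + 2))))) hgz fun x y => by
          simpa using hω.lie_left_eq_zero (hc z hz') (0, x) (0, y)
      have hez : ω e z = 0 := by
        have hdec : z = z.1 • e + (0, z.2) := by ext <;> simp [e]
        rw [hdec, map_add, map_smul, hee, hω.apply_comm_eq_zero (helast _ hz'), smul_zero, add_zero]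
      refine hω.eq_zero fun x => ?_
      have hdec : x = x.1 • e + (0, x.2) := by ext <;> simp [e]
      have hx2 : ω (0, x.2) z = 0 := (Submodule.eq_top_iff'.1 htop x.2 :)
      rw [hdec, map_add, map_smul, LinearMap.add_apply, LinearMap.smul_apply, hez, hx2, smul_zero,
        add_zero]
  simpa using this

end FreeNilpotentLieAlgebra

/-! ### A metabelian target algebra -/

/-- The metabelian Lie algebra `B ⋉ B` over a commutative algebra `B`, with bracket
`⁅(p, v), (q, w)⁆ = (0, T (p w - q v))` scaled by `T`. -/
@[ext]
structure ScaledAffine (B : Type*) (T : B) where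
  /-- The coordinate in the acting abelian Lie algebra. -/
  fst : B
  /-- The coordinate in the abelian ideal. -/
  snd : B

namespace ScaledAffine

variable {B : Type*} [CommRing B] {T : B}

/-- The underlying pair. -/
def toProd : ScaledAffine B T ≃ B × B where
  toFun x := (x.fst, x.snd)
  invFun x := ⟨x.1, x.2⟩

instance : AddCommGroup (ScaledAffine B T) := toProd.addCommGroup

@[simp] theorem fst_add (x y : ScaledAffine B T) : (x + y).fst = x.fst + y.fst := rfl
@[simp] theorem snd_add (x y : ScaledAffine B T) : (x + y).snd = x.snd + y.snd := rfl
@[simp] theorem fst_zero : (0 : ScaledAffine B T).fst = 0 := rfl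
@[simp] theorem snd_zero : (0 : ScaledAffine B T).snd = 0 := rfl

instance : Bracket (ScaledAffine B T) (ScaledAffine B T) where
  bracket x y := ⟨0, T * (x.fst * y.snd - y.fst * x.snd)⟩

@[simp] theorem fst_lie (x y : ScaledAffine B T) : ⁅x, y⁆.fst = 0 := rfl
@[simp] theorem snd_lie (x y : ScaledAffine B T) :
    ⁅x, y⁆.snd = T * (x.fst * y.snd - y.fst * x.snd) := rfl

instance : LieRing (ScaledAffine B T) where
  add_lie x y z := by ext <;> simp; ring
  lie_add x y z := by ext <;> simp; ring
  lie_self x := by ext <;> simp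
  leibniz_lie x y z := by ext <;> simp; ring

variable [Algebra ℝ B]

instance : Module ℝ (ScaledAffine B T) := toProd.module ℝ

@[simp] theorem fst_smul (c : ℝ) (x : ScaledAffine B T) : (c • x).fst = c • x.fst := rfl
@[simp] theorem snd_smul (c : ℝ) (x : ScaledAffine B T) : (c • x).snd = c • x.snd := rfl

instance : LieAlgebra ℝ (ScaledAffine B T) where
  lie_smul c x y := by ext <;> simp [← smul_sub]

/-- The projection to the abelian ideal. -/
def sndLinear : ScaledAffine B T →ₗ[ℝ] B where
  toFun := snd
  map_add' _ _ := rfl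
  map_smul' _ _ := rfl

/-- A filtration by powers of `T`. -/
def filtration (B : Type*) [CommRing B] [Algebra ℝ B] (T : B) :
    ℕ → Submodule ℝ (ScaledAffine B T)
  | 0 => ⊤
  | r + 1 =>
    { carrier := {x | x.fst = 0 ∧ T ^ (r + 1) ∣ x.snd}
      add_mem' := fun hx hy => ⟨by simp [hx.1, hy.1], dvd_add hx.2 hy.2⟩
      zero_mem' := ⟨rfl, dvd_zero _⟩
      smul_mem' := fun c x hx => ⟨by simp [hx.1], by
        rw [snd_smul, ← algebraMap_smul B, smul_eq_mul]; exact hx.2.mul_left _⟩ }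

/-- Any bracket lies in the ideal and carries a factor `T`. Once `y` itself lies in the ideal,
bracketing only multiplies its second coordinate by `T` times the acting coordinate of `x`. -/
theorem lie_mem_filtration (r : ℕ) (x y : ScaledAffine B T) (hy : y ∈ filtration B T r) :
    ⁅x, y⁆ ∈ filtration B T (r + 1) := by
  refine ⟨rfl, ?_⟩
  rw [snd_lie]
  cases r with
  | zero => simp
  | succ r =>
    rw [hy.1, zero_mul, sub_zero, pow_succ']
    exact mul_dvd_mul_left _ (hy.2.mul_left _)

theorem pow_dvd_of_mem_lowerCentralSeries {L : Type*} [LieRing L] [LieAlgebra ℝ L]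
    (φ : L →ₗ⁅ℝ⁆ ScaledAffine B T) (k : ℕ) (x : L) (hx : x ∈ lowerCentralSeries ℝ L L k) :
    T ^ k ∣ (φ x).snd := by
  have := lowerCentralSeries_le_of_filtration
    (fun r => (filtration B T r).comap (φ : L →ₗ[ℝ] ScaledAffine B T)) rfl
    (fun r x y hy => by simpa using lie_mem_filtration r _ _ hy) k hx
  cases k with
  | zero => simp
  | succ k => exact this.2

end ScaledAffine

/-! ### Lower bounds on the last term by counting exponents -/

namespace FreeNilpotentLieAlgebra

variable {m k : ℕ}

/-- The images of the generators in the acting part: `1, y, 0, 0, …`. -/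
def actingCoord (i : ℕ) : ℝ[X] := if i = 0 then 1 else if i = 1 then X else 0

/-- The images of the generators in the ideal: `0, y ^ 3, y ^ 6, …`. -/
def idealCoord (i : ℕ) : ℝ[X] := if i = 0 then 0 else X ^ (3 * i)

/-- A metabelian representation of the free Lie algebra. -/
def toAffine (m : ℕ) : FreeLieAlgebra ℝ (Fin m) →ₗ⁅ℝ⁆ ScaledAffine ℝ[X][X] X :=
  FreeLieAlgebra.lift ℝ fun i => ⟨C (actingCoord i), C (idealCoord i)⟩

/-- The leading coefficient of an element of degree `k + 1`. -/
def leadingCoeff (m k : ℕ) : FreeNilpotentLieAlgebra m (k + 1) →ₗ[ℝ] ℝ[X] :=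
  liftLinear (((lcoeff ℝ[X] k).restrictScalars ℝ).comp (ScaledAffine.sndLinear.comp
    (toAffine m : FreeLieAlgebra ℝ (Fin m) →ₗ[ℝ] ScaledAffine ℝ[X][X] X))) fun x hx => by
      have := ScaledAffine.pow_dvd_of_mem_lowerCentralSeries (toAffine m) _ x hx
      exact X_pow_dvd_iff.1 this k k.lt_succ_self

/-- Some element of the last term of the lower central series has image `y ^ n`. -/
def IsExponent (m k n : ℕ) : Prop :=
  ∃ z ∈ lowerCentralSeries ℝ (FreeLieAlgebra ℝ (Fin m)) (FreeLieAlgebra ℝ (Fin m)) k,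
    toAffine m z = ⟨0, X ^ k * C (X ^ n)⟩

theorem isExponent_one {i j n : ℕ} (hi : i < m) (hj : j < m)
    (h : actingCoord i * idealCoord j - actingCoord j * idealCoord i = X ^ n) :
    IsExponent m 1 n := by
  refine ⟨⁅FreeLieAlgebra.of ℝ ⟨i, hi⟩, FreeLieAlgebra.of ℝ ⟨j, hj⟩⁆,
    lie_mem_lowerCentralSeries _ (LieSubmodule.mem_top _), ?_⟩
  rw [LieHom.map_lie, toAffine, FreeLieAlgebra.lift_of_apply, FreeLieAlgebra.lift_of_apply]
  ext1
  · rfl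
  · rw [ScaledAffine.snd_lie, ← h]
    simp

/-- On the ideal, a generator with acting coordinate `y ^ s` multiplies by `T * y ^ s`. -/
theorem IsExponent.lie {i s n : ℕ} (hi : i < m) (h : actingCoord i = X ^ s)
    (hn : IsExponent m k n) : IsExponent m (k + 1) (n + s) := by
  obtain ⟨z, hz, hzn⟩ := hn
  refine ⟨⁅FreeLieAlgebra.of ℝ ⟨i, hi⟩, z⁆, lie_mem_lowerCentralSeries _ hz, ?_⟩
  rw [LieHom.map_lie, hzn, toAffine, FreeLieAlgebra.lift_of_apply]
  ext1
  · rfl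
  · rw [ScaledAffine.snd_lie]
    simp only [h, C_pow]
    ring

theorem isExponent_three_mul (hm : 2 ≤ m) {j : ℕ} (hj0 : 0 < j) (hj : j < m) (k : ℕ) :
    IsExponent m (k + 1) (3 * j) := by
  induction k with
  | zero =>
    refine isExponent_one (i := 0) (by omega) hj ?_
    simp [actingCoord, idealCoord, hj0.ne']
  | succ k ih => exact ih.lie (i := 0) (s := 0) (by omega) (by simp [actingCoord])

theorem isExponent_three_mul_add_one (hm : 2 ≤ m) {j : ℕ} (hj1 : 1 < j) (hj : j < m) (k : ℕ) :
    IsExponent m (k + 1) (3 * j + 1) := by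
  induction k with
  | zero =>
    refine isExponent_one (i := 1) (by omega) hj ?_
    simp [actingCoord, idealCoord, hj1.ne', (zero_lt_one.trans hj1).ne', pow_succ']
  | succ k ih => exact ih.lie (i := 0) (s := 0) (by omega) (by simp [actingCoord])

/-- Start from the exponent 3 of `[x_0, x_1]`, bracket `k` times with `x_0`, then `s` times with
`x_1`, each of which raises the exponent by one. -/
theorem isExponent_three_mul_add (hm : 2 ≤ m) (s k : ℕ) :
    IsExponent m (k + s + 1) (3 + s) := by
  induction s with
  | zero => exact isExponent_three_mul hm one_pos (by omega) k
  | succ s ih => exact ih.lie (i := 1) (s := 1) (by omega) (by simp [actingCoord])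

/-- Distinct exponents give linearly independent elements. -/
theorem exists_linearIndependent (S : Finset ℕ) (hS : ∀ n ∈ S, IsExponent m k n) :
    ∃ w : S → FreeNilpotentLieAlgebra m (k + 1), LinearIndependent ℝ w ∧ ∀ i, w i ∈ last m k := by
  choose z hz hzn using fun n : S => hS n n.2
  refine ⟨fun n => proj m (k + 1) (z n), LinearIndependent.of_comp (leadingCoeff m k) ?_,
    fun n => ⟨z n, hz n, rfl⟩⟩
  have : leadingCoeff m k ∘ (fun n => proj m (k + 1) (z n)) =
      (basisMonomials ℝ) ∘ ((↑) : S → ℕ) := by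
    ext1 n
    change (toAffine m (z n)).snd.coeff k = basisMonomials ℝ n
    rw [hzn, coeff_mul_C, coeff_X_pow_self, one_mul, coe_basisMonomials, X_pow_eq_monomial]
  rw [this]
  exact (basisMonomials ℝ).linearIndependent.comp _ Subtype.val_injective

theorem card_image_three_mul (m : ℕ) :
    ((Finset.Ico 1 m).image (3 * ·)).card = m - 1 := by
  rw [Finset.card_image_of_injective _ (mul_right_injective₀ three_ne_zero), Nat.card_Ico]

/-- Many exponents occur, except in a few small cases. -/
theorem exists_card_eq (hm : 2 ≤ m) (h2 : k = 0 → 4 ≤ m) (h3 : m = 2 → 2 ≤ k) :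
    ∃ S : Finset ℕ, S.card = m + 1 ∧ ∀ n ∈ S, IsExponent m (k + 1) n := by
  have hfour : 1 ≤ k → IsExponent m (k + 1) 4 := fun hk => by
    obtain ⟨l, rfl⟩ := Nat.exists_eq_add_of_le' hk
    exact isExponent_three_mul_add hm 1 l
  obtain rfl | rfl | hm4 : m = 2 ∨ m = 3 ∨ 4 ≤ m := by omega
  -- With two generators, exponent 5 takes two further brackets with `x_1`, which forces `2 ≤ k`.
  · refine ⟨{3, 4, 5}, rfl, ?_⟩
    obtain ⟨l, rfl⟩ := Nat.exists_eq_add_of_le' (h3 rfl)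
    simp only [Finset.mem_insert, Finset.mem_singleton, forall_eq_or_imp, forall_eq]
    exact ⟨isExponent_three_mul hm one_pos (by omega) _, hfour (by omega),
      isExponent_three_mul_add hm 2 l⟩
  · refine ⟨{3, 4, 6, 7}, rfl, ?_⟩
    simp only [Finset.mem_insert, Finset.mem_singleton, forall_eq_or_imp, forall_eq]
    exact ⟨isExponent_three_mul hm one_pos (by omega) _, hfour (by omega),
      isExponent_three_mul hm two_pos (by omega) _,
      isExponent_three_mul_add_one hm one_lt_two (by omega) _⟩
  -- The `m - 1` multiples of 3 are joined by `7 = 3 * 2 + 1` and `10 = 3 * 3 + 1`, available in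
  -- every degree once the generators `x_2` and `x_3` exist.
  · refine ⟨insert 7 (insert 10 ((Finset.Ico 1 m).image (3 * ·))), ?_, ?_⟩
    · rw [Finset.card_insert_of_notMem, Finset.card_insert_of_notMem, card_image_three_mul]
      · omega
      · simp only [Finset.mem_image, not_exists]
        omega
      · simp only [Finset.mem_insert, Finset.mem_image, not_or, not_exists]
        exact ⟨by omega, fun j => by omega⟩
    · simp only [Finset.mem_insert, Finset.forall_mem_image, forall_eq_or_imp, Finset.mem_Ico]
      exact ⟨isExponent_three_mul_add_one hm one_lt_two (by omega) _,
        isExponent_three_mul_add_one hm (j := 3) (by omega) (by omega) _,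
        fun j hj => isExponent_three_mul hm (by omega) hj.2 _⟩

theorem exists_card_eq_of_pos (hm : 2 ≤ m) (h : m = 2 → 1 ≤ k) :
    ∃ S : Finset ℕ, S.card = m ∧ ∀ n ∈ S, IsExponent m (k + 1) n := by
  obtain rfl | hm3 : m = 2 ∨ 3 ≤ m := by omega
  · refine ⟨{3, 4}, rfl, ?_⟩
    obtain ⟨l, rfl⟩ := Nat.exists_eq_add_of_le' (h rfl)
    simp only [Finset.mem_insert, Finset.mem_singleton, forall_eq_or_imp, forall_eq]
    exact ⟨isExponent_three_mul hm one_pos (by omega) _, isExponent_three_mul_add hm 1 l⟩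
  · refine ⟨insert 7 ((Finset.Ico 1 m).image (3 * ·)), ?_, ?_⟩
    · rw [Finset.card_insert_of_notMem, card_image_three_mul]
      · omega
      · simp only [Finset.mem_image, not_exists]
        omega
    · simp only [Finset.mem_insert, Finset.forall_mem_image, forall_eq_or_imp, Finset.mem_Ico]
      exact ⟨isExponent_three_mul_add_one hm one_lt_two (by omega) _,
        fun j hj => isExponent_three_mul hm (by omega) hj.2 _⟩

theorem not_isSymplectic (hm : 2 ≤ m) (h2 : k = 0 → 4 ≤ m) (h3 : m = 2 → 2 ≤ k) :
    ¬ IsSymplecticLieAlgebra (FreeNilpotentLieAlgebra m (k + 2)) := by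
  intro h
  obtain ⟨S, hcard, hS⟩ := exists_card_eq hm h2 h3
  obtain ⟨w, hw, hlast⟩ := exists_linearIndependent S hS
  have := card_le_of_isSymplectic h w hw hlast
  rw [Fintype.card_coe] at this
  omega

theorem not_isSymplectic_prod (hm : 2 ≤ m) (h : m = 2 → 1 ≤ k) :
    ¬ IsSymplecticLieAlgebra (ℝ × FreeNilpotentLieAlgebra m (k + 2)) := by
  intro h'
  obtain ⟨S, hcard, hS⟩ := exists_card_eq_of_pos hm h
  obtain ⟨w, hw, hlast⟩ := exists_linearIndependent S hS
  have := card_lt_of_isSymplectic_prod h' w hw hlast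
  rw [Fintype.card_coe] at this
  omega

end FreeNilpotentLieAlgebra

/-! ### Coordinate models of the small free nilpotent algebras -/

/-- A real Lie algebra structure on coordinate space. -/
structure CoordLieStructure (N : ℕ) where
  /-- The bracket. -/
  bracket : (Fin N → ℝ) →ₗ[ℝ] (Fin N → ℝ) →ₗ[ℝ] (Fin N → ℝ)
  bracket_self : ∀ x, bracket x x = 0
  leibniz : ∀ x y z, bracket x (bracket y z) = bracket (bracket x y) z + bracket y (bracket x z)

/-- Coordinate space with a Lie algebra structure. -/
def CoordLieStructure.Alg {N : ℕ} (_ : CoordLieStructure N) : Type := Fin N → ℝ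

namespace CoordLieStructure

variable {N : ℕ} {b : CoordLieStructure N}

instance : AddCommGroup b.Alg := inferInstanceAs (AddCommGroup (Fin N → ℝ))

instance : Module ℝ b.Alg := inferInstanceAs (Module ℝ (Fin N → ℝ))

instance : LieRing b.Alg where
  bracket x y := b.bracket x y
  add_lie x y z := congrArg (fun f => f z) (b.bracket.map_add x y)
  lie_add x y z := (b.bracket x).map_add y z
  lie_self := b.bracket_self
  leibniz_lie := b.leibniz

instance : LieAlgebra ℝ b.Alg where
  lie_smul c x y := (b.bracket x).map_smul c y

@[simp] theorem add_apply (x y : b.Alg) (i : Fin N) : (x + y) i = x i + y i := rfl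
@[simp] theorem zero_apply (i : Fin N) : (0 : b.Alg) i = 0 := rfl
@[simp] theorem smul_apply (c : ℝ) (x : b.Alg) (i : Fin N) : (c • x) i = c * x i := rfl

theorem finrank_alg (b : CoordLieStructure N) : Module.finrank ℝ b.Alg = N :=
  Module.finrank_fin_fun ℝ

/-- The subspace where the coordinates of weight at most `r` vanish. -/
def weightFiltration (b : CoordLieStructure N) (wt : Fin N → ℕ) (r : ℕ) : Submodule ℝ b.Alg where
  carrier := {x | ∀ i, wt i ≤ r → x i = 0}
  add_mem' hx hy i hi := by simp [hx i hi, hy i hi]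
  zero_mem' _ _ := rfl
  smul_mem' c x hx i hi := by simp [hx i hi]

/-- A graded presentation of a free nilpotent Lie algebra in coordinates. -/
theorem exists_bijective {m k : ℕ} (b : CoordLieStructure N) (wt : Fin N → ℕ)
    (hpos : ∀ i, 0 < wt i) (hle : ∀ i, wt i ≤ k)
    (hwt : ∀ r, ∀ x y : Fin N → ℝ, (∀ i, wt i ≤ r → y i = 0) →
      ∀ i, wt i ≤ r + 1 → b.bracket x y i = 0)
    (hmN : m ≤ N) (e : Fin N → FreeNilpotentLieAlgebra m k)
    (he : ∀ i : Fin m, e (Fin.castLE hmN i) = FreeNilpotentLieAlgebra.gen m k i)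
    (hlie : ∀ x y : Fin N → ℝ, ∑ i, b.bracket x y i • e i = ⁅∑ i, x i • e i, ∑ i, y i • e i⁆)
    (hψ : ∀ ψ : FreeNilpotentLieAlgebra m k → (Fin N → ℝ),
      (∀ x y, ψ ⁅x, y⁆ = b.bracket (ψ x) (ψ y)) →
      (∀ i : Fin m, ψ (e (Fin.castLE hmN i)) = Pi.single (Fin.castLE hmN i) 1) →
      ∀ i, ψ (e i) = Pi.single i 1) :
    ∃ ψ : FreeNilpotentLieAlgebra m k →ₗ⁅ℝ⁆ b.Alg, Function.Bijective ψ := by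
  refine FreeNilpotentLieAlgebra.exists_bijective_of_section
    (fun i => (Pi.single (Fin.castLE hmN i) 1 : Fin N → ℝ)) (b.weightFiltration wt)
    ?_ (fun r x y hy => hwt r x y hy) ?_ (Fintype.linearCombination ℝ e) hlie (fun i => ?_)
    fun ψ hgen x => ?_
  · exact Submodule.eq_top_iff'.2 fun x i hi => absurd (hpos i) hi.not_gt
  · exact (Submodule.eq_bot_iff _).2 fun x hx => funext fun i => hx i (hle i)
  · rw [← he]
    exact (Fintype.linearCombination_apply_single ℝ e _ _).trans (one_smul _ _)
  · have h := hψ ψ (fun x y => ψ.map_lie x y) fun i => by rw [he]; exact hgen i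
    let ψ' : FreeNilpotentLieAlgebra m k →ₗ[ℝ] Fin N → ℝ :=
      (ψ : FreeNilpotentLieAlgebra m k →ₗ[ℝ] b.Alg)
    -- Both sides are linear, so it suffices to compare them on the standard basis.
    have : ψ' ∘ₗ Fintype.linearCombination ℝ e =
        LinearMap.id := LinearMap.pi_ext' fun i => LinearMap.ext_ring <| by
      refine Eq.trans ?_ (h i)
      exact congrArg ψ ((Fintype.linearCombination_apply_single ℝ e _ _).trans (one_smul _ _))
    exact LinearMap.congr_fun this x

end CoordLieStructure

/-- The three-dimensional Heisenberg algebra. -/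
def heisenberg : CoordLieStructure 3 where
  bracket := LinearMap.mk₂ ℝ (fun u v => ![0, 0, u 0 * v 1 - u 1 * v 0])
    (fun _ _ _ => by ext i; fin_cases i <;> simp; ring)
    (fun _ _ _ => by ext i; fin_cases i <;> simp; ring)
    (fun _ _ _ => by ext i; fin_cases i <;> simp; ring)
    (fun _ _ _ => by ext i; fin_cases i <;> simp; ring)
  bracket_self x := by ext i; fin_cases i <;> simp; ring
  leibniz x y z := by ext i; fin_cases i <;> simp

/-- The free three-step nilpotent Lie algebra on two generators, in coordinates. -/
def cartanFive : CoordLieStructure 5 where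
  bracket := LinearMap.mk₂ ℝ (fun u v => ![0, 0, u 0 * v 1 - u 1 * v 0,
      u 0 * v 2 - u 2 * v 0, u 1 * v 2 - u 2 * v 1])
    (fun _ _ _ => by ext i; fin_cases i <;> simp <;> ring)
    (fun _ _ _ => by ext i; fin_cases i <;> simp <;> ring)
    (fun _ _ _ => by ext i; fin_cases i <;> simp <;> ring)
    (fun _ _ _ => by ext i; fin_cases i <;> simp <;> ring)
  bracket_self x := by ext i; fin_cases i <;> simp <;> ring
  leibniz x y z := by ext i; fin_cases i <;> simp <;> ring

/-- The free two-step nilpotent Lie algebra on three generators, in coordinates. -/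
def freeTwoStepThree : CoordLieStructure 6 where
  bracket := LinearMap.mk₂ ℝ (fun u v => ![0, 0, 0, u 0 * v 1 - u 1 * v 0,
      u 0 * v 2 - u 2 * v 0, u 1 * v 2 - u 2 * v 1])
    (fun _ _ _ => by ext i; fin_cases i <;> simp <;> ring)
    (fun _ _ _ => by ext i; fin_cases i <;> simp <;> ring)
    (fun _ _ _ => by ext i; fin_cases i <;> simp <;> ring)
    (fun _ _ _ => by ext i; fin_cases i <;> simp <;> ring)
  bracket_self x := by ext i; fin_cases i <;> simp <;> ring
  leibniz x y z := by ext i; fin_cases i <;> simp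

theorem heisenberg_bracket (u v : Fin 3 → ℝ) :
    heisenberg.bracket u v = ![0, 0, u 0 * v 1 - u 1 * v 0] := rfl

theorem cartanFive_bracket (u v : Fin 5 → ℝ) :
    cartanFive.bracket u v = ![0, 0, u 0 * v 1 - u 1 * v 0,
      u 0 * v 2 - u 2 * v 0, u 1 * v 2 - u 2 * v 1] := rfl

theorem freeTwoStepThree_bracket (u v : Fin 6 → ℝ) :
    freeTwoStepThree.bracket u v = ![0, 0, 0, u 0 * v 1 - u 1 * v 0,
      u 0 * v 2 - u 2 * v 0, u 1 * v 2 - u 2 * v 1] := rfl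

/-! ### Identification of the small cases with their models -/

namespace FreeNilpotentLieAlgebra

variable {m : ℕ}

theorem lie_lie_eq_zero (x y z : FreeNilpotentLieAlgebra m 2) : ⁅x, ⁅y, z⁆⁆ = 0 := by
  obtain ⟨y, rfl⟩ := proj_surjective y
  obtain ⟨z, rfl⟩ := proj_surjective z
  rw [← LieHom.map_lie]
  exact lie_proj_eq_zero (lie_mem_lowerCentralSeries y (LieSubmodule.mem_top z)) x

theorem lie_lie_lie_eq_zero (x y z w : FreeNilpotentLieAlgebra m 3) : ⁅x, ⁅y, ⁅z, w⁆⁆⁆ = 0 := by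
  obtain ⟨y, rfl⟩ := proj_surjective y
  obtain ⟨z, rfl⟩ := proj_surjective z
  obtain ⟨w, rfl⟩ := proj_surjective w
  rw [← LieHom.map_lie, ← LieHom.map_lie]
  exact lie_proj_eq_zero (lie_mem_lowerCentralSeries y
    (lie_mem_lowerCentralSeries z (LieSubmodule.mem_top w))) x

theorem exists_bijective_heisenberg :
    ∃ ψ : FreeNilpotentLieAlgebra 2 2 →ₗ⁅ℝ⁆ heisenberg.Alg, Function.Bijective ψ := by
  set x := gen 2 2 0
  set y := gen 2 2 1
  have h0 : ∀ u v w : FreeNilpotentLieAlgebra 2 2, ⁅⁅u, v⁆, w⁆ = 0 := fun u v w => by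
    rw [← lie_skew, lie_lie_eq_zero, neg_zero]
  refine heisenberg.exists_bijective ![1, 1, 2] (by decide) (by decide) (fun r u v hv i => ?_)
    (by decide) ![x, y, ⁅x, y⁆] (fun i => ?_) (fun u v => ?_) fun ψ hlie hgen i => ?_
  · rw [heisenberg_bracket]
    fin_cases i
    · simp
    · simp
    · intro hr
      have hr : 1 ≤ r := Nat.le_of_succ_le_succ hr
      simp [hv 0 hr, hv 1 hr]
  · fin_cases i <;> rfl
  · rw [heisenberg_bracket]
    simp only [Fin.sum_univ_three, lie_add, add_lie, lie_smul, smul_lie, Matrix.cons_val,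
      lie_lie_eq_zero, h0, lie_self, ← lie_skew y x]
    module
  · have hψ0 : ψ x = Pi.single 0 1 := hgen 0
    have hψ1 : ψ y = Pi.single 1 1 := hgen 1
    fin_cases i
    · exact hψ0
    · exact hψ1
    · refine (hlie x y).trans ?_
      rw [hψ0, hψ1, heisenberg_bracket]
      ext j
      fin_cases j <;> simp

theorem exists_bijective_cartanFive :
    ∃ ψ : FreeNilpotentLieAlgebra 2 3 →ₗ⁅ℝ⁆ cartanFive.Alg, Function.Bijective ψ := by
  set x := gen 2 3 0
  set y := gen 2 3 1
  have h0 : ∀ u v w z : FreeNilpotentLieAlgebra 2 3, ⁅⁅z, ⁅u, v⁆⁆, w⁆ = 0 := fun u v w z => by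
    rw [← lie_skew, lie_lie_lie_eq_zero, neg_zero]
  refine cartanFive.exists_bijective ![1, 1, 2, 3, 3] (by decide) (by decide) (fun r u v hv i => ?_)
    (by decide) ![x, y, ⁅x, y⁆, ⁅x, ⁅x, y⁆⁆, ⁅y, ⁅x, y⁆⁆] (fun i => ?_) (fun u v => ?_)
    fun ψ hlie hgen i => ?_
  · rw [cartanFive_bracket]
    fin_cases i
    · simp
    · simp
    · intro hr
      have hr : 1 ≤ r := Nat.le_of_succ_le_succ hr
      simp [hv 0 hr, hv 1 hr]
    · intro hr
      have hr : 2 ≤ r := Nat.le_of_succ_le_succ hr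
      simp [hv 0 (one_le_two.trans hr), hv 2 hr]
    · intro hr
      have hr : 2 ≤ r := Nat.le_of_succ_le_succ hr
      simp [hv 1 (one_le_two.trans hr), hv 2 hr]
  · fin_cases i <;> rfl
  · rw [cartanFive_bracket]
    simp only [Fin.sum_univ_five, lie_add, add_lie, lie_smul, smul_lie, Matrix.cons_val,
      lie_lie_lie_eq_zero, h0, lie_self, ← lie_skew ⁅x, y⁆ x, ← lie_skew ⁅x, y⁆ y, ← lie_skew y x]
    module
  · have hψ0 : ψ x = Pi.single 0 1 := hgen 0
    have hψ1 : ψ y = Pi.single 1 1 := hgen 1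
    have hψ2 : ψ ⁅x, y⁆ = Pi.single 2 1 := by
      rw [hlie, hψ0, hψ1, cartanFive_bracket]
      ext j
      fin_cases j <;> simp
    fin_cases i
    · exact hψ0
    · exact hψ1
    · exact hψ2
    · refine (hlie x _).trans ?_
      rw [hψ0, hψ2, cartanFive_bracket]
      ext j
      fin_cases j <;> simp
    · refine (hlie y _).trans ?_
      rw [hψ1, hψ2, cartanFive_bracket]
      ext j
      fin_cases j <;> simp

theorem exists_bijective_freeTwoStepThree :
    ∃ ψ : FreeNilpotentLieAlgebra 3 2 →ₗ⁅ℝ⁆ freeTwoStepThree.Alg, Function.Bijective ψ := by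
  set x := gen 3 2 0
  set y := gen 3 2 1
  set z := gen 3 2 2
  have h0 : ∀ u v w : FreeNilpotentLieAlgebra 3 2, ⁅⁅u, v⁆, w⁆ = 0 := fun u v w => by
    rw [← lie_skew, lie_lie_eq_zero, neg_zero]
  refine freeTwoStepThree.exists_bijective ![1, 1, 1, 2, 2, 2] (by decide) (by decide)
    (fun r u v hv i => ?_) (by decide) ![x, y, z, ⁅x, y⁆, ⁅x, z⁆, ⁅y, z⁆] (fun i => ?_)
    (fun u v => ?_) fun ψ hlie hgen i => ?_
  · rw [freeTwoStepThree_bracket]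
    fin_cases i
    iterate 3 simp
    all_goals
      intro hr
      have hr : 1 ≤ r := Nat.le_of_succ_le_succ hr
      simp [hv 0 hr, hv 1 hr, hv 2 hr]
  · fin_cases i <;> rfl
  · rw [freeTwoStepThree_bracket]
    simp only [Fin.sum_univ_six, lie_add, add_lie, lie_smul, smul_lie, Matrix.cons_val,
      lie_lie_eq_zero, h0, lie_self, ← lie_skew y x, ← lie_skew z x, ← lie_skew z y]
    module
  · have hψ0 : ψ x = Pi.single 0 1 := hgen 0
    have hψ1 : ψ y = Pi.single 1 1 := hgen 1
    have hψ2 : ψ z = Pi.single 2 1 := hgen 2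
    fin_cases i
    · exact hψ0
    · exact hψ1
    · exact hψ2
    · refine (hlie x y).trans ?_
      rw [hψ0, hψ1, freeTwoStepThree_bracket]
      ext j
      fin_cases j <;> simp
    · refine (hlie x z).trans ?_
      rw [hψ0, hψ2, freeTwoStepThree_bracket]
      ext j
      fin_cases j <;> simp
    · refine (hlie y z).trans ?_
      rw [hψ1, hψ2, freeTwoStepThree_bracket]
      ext j
      fin_cases j <;> simp

theorem finrank_two_two : Module.finrank ℝ (FreeNilpotentLieAlgebra 2 2) = 3 :=
  let ⟨ψ, hψ⟩ := exists_bijective_heisenberg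
  (LinearEquiv.ofBijective (ψ : _ →ₗ[ℝ] heisenberg.Alg) hψ).finrank_eq.trans heisenberg.finrank_alg

theorem finrank_two_three : Module.finrank ℝ (FreeNilpotentLieAlgebra 2 3) = 5 :=
  let ⟨ψ, hψ⟩ := exists_bijective_cartanFive
  (LinearEquiv.ofBijective (ψ : _ →ₗ[ℝ] cartanFive.Alg) hψ).finrank_eq.trans cartanFive.finrank_alg

end FreeNilpotentLieAlgebra

/-! ### Explicit symplectic forms -/

theorem isSymplectic_freeTwoStepThree : IsSymplecticLieAlgebra freeTwoStepThree.Alg := by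
  let ω : LinearMap.BilinForm ℝ freeTwoStepThree.Alg := LinearMap.mk₂ ℝ
    -- The only nontrivial closedness condition is on the three generators: `ω e₃ e₂ + ω e₅ e₀ - ω
    -- e₄ e₁ = 0`. The coefficients 1, 1, 2 satisfy it with none of them zero.
    (fun u v => u 5 * v 0 - v 5 * u 0 + (u 3 * v 2 - v 3 * u 2) + 2 * (u 4 * v 1 - v 4 * u 1))
    (fun _ _ _ => by simp; ring) (fun _ _ _ => by simp; ring)
    (fun _ _ _ => by simp; ring) (fun _ _ _ => by simp; ring)
  have hω : ∀ u v, ω u v =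
    u 5 * v 0 - v 5 * u 0 + (u 3 * v 2 - v 3 * u 2) + 2 * (u 4 * v 1 - v 4 * u 1) := fun _ _ => rfl
  refine ⟨ω, .of_separatingLeft (fun x => ?_) (fun x y z => ?_) fun x hx => ?_⟩
  · rw [hω]
    ring
  · have hb : ∀ (u v : freeTwoStepThree.Alg) (i : Fin 6), ⁅u, v⁆ i =
        (![0, 0, 0, u 0 * v 1 - u 1 * v 0, u 0 * v 2 - u 2 * v 0, u 1 * v 2 - u 2 * v 1] :
          Fin 6 → ℝ) i := fun _ _ _ => rfl
    simp only [hω, hb, Matrix.cons_val]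
    ring
  · have h : ∀ v : Fin 6 → ℝ, x 5 * v 0 - v 5 * x 0 + (x 3 * v 2 - v 3 * x 2) +
        2 * (x 4 * v 1 - v 4 * x 1) = 0 := hx
    have h0 := h (Pi.single 0 1)
    have h1 := h (Pi.single 1 1)
    have h2 := h (Pi.single 2 1)
    have h3 := h (Pi.single 3 1)
    have h4 := h (Pi.single 4 1)
    have h5 := h (Pi.single 5 1)
    funext i
    simp at h0 h1 h2 h3 h4 h5
    fin_cases i <;> assumption

/-- The form pairs `e₂` with `e₀` and the extra direction with `e₁`. It is closed because every
bracket is a multiple of `e₂`, which pairs only with `e₀`. -/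
theorem isSymplectic_prod_heisenberg : IsSymplecticLieAlgebra (ℝ × heisenberg.Alg) := by
  let ω : LinearMap.BilinForm ℝ (ℝ × heisenberg.Alg) := LinearMap.mk₂ ℝ
    (fun u v => u.2 2 * v.2 0 - v.2 2 * u.2 0 + (u.1 * v.2 1 - v.1 * u.2 1))
    (fun _ _ _ => by simp; ring) (fun _ _ _ => by simp; ring)
    (fun _ _ _ => by simp; ring) (fun _ _ _ => by simp; ring)
  have hω : ∀ u v, ω u v =
    u.2 2 * v.2 0 - v.2 2 * u.2 0 + (u.1 * v.2 1 - v.1 * u.2 1) := fun _ _ => rfl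
  refine ⟨ω, .of_separatingLeft (fun x => ?_) (fun x y z => ?_) fun x hx => ?_⟩
  · rw [hω]
    ring
  · have hb : ∀ (u v : heisenberg.Alg) (i : Fin 3), ⁅u, v⁆ i =
        (![0, 0, u 0 * v 1 - u 1 * v 0] : Fin 3 → ℝ) i := fun _ _ _ => rfl
    simp only [hω, LieAlgebra.Prod.bracket_apply, LieRing.of_associative_ring_bracket, hb,
      Matrix.cons_val]
    ring
  · have h : ∀ (t : ℝ) (v : Fin 3 → ℝ),
        x.2 2 * v 0 - v 2 * x.2 0 + (x.1 * v 1 - t * x.2 1) = 0 := fun t v => hx (t, v)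
    have h' := h 1 0
    have h0 := h 0 (Pi.single 0 1)
    have h1 := h 0 (Pi.single 1 1)
    have h2 := h 0 (Pi.single 2 1)
    simp at h' h0 h1 h2
    refine Prod.ext h1 (funext fun i => ?_)
    fin_cases i <;> assumption

namespace FreeNilpotentLieAlgebra

theorem isSymplectic_three_two : IsSymplecticLieAlgebra (FreeNilpotentLieAlgebra 3 2) :=
  let ⟨ψ, hψ⟩ := exists_bijective_freeTwoStepThree
  isSymplectic_freeTwoStepThree.of_bijective ψ hψ

theorem isSymplectic_prod_two_two : IsSymplecticLieAlgebra (ℝ × FreeNilpotentLieAlgebra 2 2) :=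
  let ⟨ψ, hψ⟩ := exists_bijective_heisenberg
  isSymplectic_prod_heisenberg.of_bijective (LieHom.prodMap LieHom.id ψ)
    (Function.bijective_id.prodMap hψ)

end FreeNilpotentLieAlgebra

end

/-! ### The classification -/

theorem mainTheorem1 (m k : ℕ) (hm : 2 ≤ m) (hk : 2 ≤ k) :
    (Even (Module.finrank ℝ (FreeNilpotentLieAlgebra m k)) →
      (IsSymplecticLieAlgebra (FreeNilpotentLieAlgebra m k) ↔ (m, k) = (3, 2))) ∧
    (Odd (Module.finrank ℝ (FreeNilpotentLieAlgebra m k)) →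
      (IsSymplecticLieAlgebra (ℝ × FreeNilpotentLieAlgebra m k) ↔ (m, k) = (2, 2))) := by
  refine ⟨fun heven => ⟨fun h => ?_, fun h => ?_⟩, fun _ => ⟨fun h => ?_, fun h => ?_⟩⟩
  -- For `(2, 2)` and `(2, 3)` the last term has dimension 1 and 2, within the bound `m`; only
  -- parity excludes these cases.
  · have h22 : ¬ (m = 2 ∧ k = 2) := by
      rintro ⟨rfl, rfl⟩
      rw [FreeNilpotentLieAlgebra.finrank_two_two] at heven
      revert heven
      decide
    have h23 : ¬ (m = 2 ∧ k = 3) := by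
      rintro ⟨rfl, rfl⟩
      rw [FreeNilpotentLieAlgebra.finrank_two_three] at heven
      revert heven
      decide
    obtain ⟨k, rfl⟩ := Nat.exists_eq_add_of_le' hk
    by_contra hne
    rw [Prod.mk.injEq] at hne
    exact FreeNilpotentLieAlgebra.not_isSymplectic hm (by omega) (by omega) h
  · obtain ⟨rfl, rfl⟩ := Prod.mk.injEq .. ▸ h
    exact FreeNilpotentLieAlgebra.isSymplectic_three_two
  · obtain ⟨k, rfl⟩ := Nat.exists_eq_add_of_le' hk
    by_contra hne
    rw [Prod.mk.injEq] at hne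
    exact FreeNilpotentLieAlgebra.not_isSymplectic_prod hm (by omega) h
  · obtain ⟨rfl, rfl⟩ := Prod.mk.injEq .. ▸ h
    exact FreeNilpotentLieAlgebra.isSymplectic_prod_two_two
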